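/- **Setting.** Consider $\min \sum_{i=1}^N f_i(x_i)+g(\bar x)$ subject to $Ax+B\bar x=b$, where $x=(x_1,\dots,x_N)$, $x_i\in\mathbb R^{n_i}$, $\bar x\in\mathbb R^p$, $b\in\mathbb R^m$, $Ax=\sum_i A_ix_i$, and put $f(x)=\sum_i f_i(x_i)$. All norms are Euclidean. For a function $h$ let $h^\circ(x;d)=\limsup_{y\to x,\,t\downarrow0}\frac{h(y+td)-h(y)}{t}$ and $\partial_Ch(x)=\{\xi: h^\circ(x;d)\ge\xi^\top d\ \ \forall d\}$; $\partial g$ is the convex subdifferential. **Nonsmooth trust-region solver.** Constants $\bar\eta_1,\bar\theta,\bar\epsilon,\bar\zeta,\bar p,\delta>0$ and $0<\bar\zeta_1<1\le\bar\zeta_2$. Given an objective $h$, a starting point $x^0$, a radius $\Delta^0>0$ and $G=\emptyset$, iteration $q$ is as follows. Generate a unit vector $g^q$, a finite sample set $Y^q$ with $\|y-x^q\|\le\bar\zeta\Delta^q$ for $y\in Y^q$, and a symmetric matrix $H^q$; add $g^q$ to $G$; find a (global) solution $(s,\alpha)$ of $$\min_{s,\alpha}\ \tfrac12s^\top H^qs+\alpha\quad\text{s.t.}\quad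 h(x^q)-\tilde\beta_v+v^\top s\le\alpha\ (v\in G),\quad \|s\|^2\le(\Delta^q)^2,$$ where $\tilde\beta_v=\max_{y\in Y^q}\max\{0,\,h(x^q)-h(y)+v^\top(y-x^q)+\delta\|y-x^q\|^2\}$, with Lagrange multipliers $\lambda_v\ge0$ of the linear constraints, $\sum_v\lambda_v=1$. If $\|\sum_{v\in G}\lambda_vv\|<\bar\epsilon(\Delta^q)^{1/2}$, reset $G=\{g^q\}$ and replace $s$ by a solution of the subproblem for this $G$. Put $s^q=s$. If $\frac{h(x^q)-h(x^q+s^q)}{\bar\theta\|s^q\|^{\bar p+1}}\ge\bar\eta_1$, set $x^{q+1}=x^q+s^q$ and $\Delta^{q+1}=\bar\zeta_2\Delta^q$; otherwise set $x^{q+1}=x^q$ and $\Delta^{q+1}=\bar\zeta_1\Delta^q$. The solver stops at the first index $q^\star$ at which $\Delta^{q^\star}$ is at most a prescribed tolerance. **Inner loop.** Fix an outer iteration $k$, with $\lambda^k\in\mathbb R^m$, $\beta^k>0$, $\rho^k=2\beta^k$, tolerances $\epsilon^k_1,\dots,\epsilon^k_4>0$, and radius tolerances $\epsilon_4^{k,r}>0$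 $(r=0,1,\dots)$ such that $\epsilon^{k,r}_4\le\epsilon^k_4$ for infinitely many $r$. Start from $x^{k,0},\bar x^{k,0},z^{k,0},y^{k,0}$ with $\lambda^k+\beta^kz^{k,0}+y^{k,0}=0$. Iteration $r$ first runs, for $i=1,\dots,N$ in this order, the solver with tolerance $\epsilon_4^{k,r}$, started at $x_i^{k,r}$, on $$I_i(u)=f_i(u)+\tfrac{\rho^k}{2}\Big\|A_iu+\sum_{j<i}A_jx_j^{k,r+1}+\sum_{j>i}A_jx_j^{k,r}+B\bar x^{k,r}+z^{k,r}-b+\tfrac{y^{k,r}}{\rho^k}\Big\|^2 ;$$ the final iterate is $x_i^{k,r+1}$, and $\Delta^{k,r+1}$ denotes the largest of the $N$ final radii. Then $$\bar x^{k,r+1}=\arg\min_{\bar x}\ g(\bar x)+\tfrac{\rho^k}2\Big\|Ax^{k,r+1}+B\bar x+z^{k,r}-b+\tfrac{y^{k,r}}{\rho^k}\Big\|^2,$$ $$z^{k,r+1}=-\tfrac{\rho^k}{\rho^k+\beta^k}\Big(Ax^{k,r+1}+B\bar x^{k,r+1}+\tfrac{y^{k,r}}{\rho^k}-b\Big)-\tfrac1{\rho^k+\beta^k}\lambda^k,$$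 $$y^{k,r+1}=y^{k,r}+\rho^k\big(Ax^{k,r+1}+B\bar x^{k,r+1}+z^{k,r+1}-b\big).$$ The loop stops at the first $r$ for which $$\big\|\rho^kA^\top(B\bar x^{k,r+1}+z^{k,r+1}-B\bar x^{k,r}-z^{k,r})\big\|\le\epsilon_1^k,\qquad \big\|\rho^kB^\top(z^{k,r+1}-z^{k,r})\big\|\le\epsilon_2^k,$$ $$\big\|Ax^{k,r+1}+B\bar x^{k,r+1}+z^{k,r+1}-b\big\|\le\epsilon_3^k,\qquad \Delta^{k,r+1}\le\epsilon_4^{k,r}\le\epsilon_4^k .$$ **Assumptions.** (a) Each $f_i$ is locally Lipschitz and bounded below. (b) $g$ is convex and bounded below, and the $\bar x$-subproblem $\min_{\bar x}g(\bar x)+\frac{\rho^k}2\|B\bar x+v\|^2$ has a unique minimizer for every $v\in\mathbb R^m$. (c) For each run of the solver there are $\vartheta\in(0,1/2)$ and $m_H,M_H>0$ with $\lambda_{\max}(H^q)\le M_H(\Delta^q)^{-\vartheta}$ and $-\lambda_{\min}(H^q)\le m_H(\Delta^q)^{-\vartheta}$ for all executed iterations $q$. (d) There is $C_2>0$ such that,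 whenever the solver terminates at radius $\Delta^{k,r+1}$, $\operatorname{dist}\big(0,\partial_Ch^{k,r}(x^{k,r+1})\big)\le C_2\,\Delta^{k,r+1}$, where $h^{k,r}(x)=f(x)+\frac{\rho^k}2\big\|Ax+B\bar x^{k,r}+z^{k,r}-b+\frac{y^{k,r}}{\rho^k}\big\|^2$ is the objective of the $x$-subproblem in the concatenated variable $x$. **Conclusion.** Every call of the solver terminates after finitely many iterations, the inner loop stops at a finite $r$, and at this $r$ there are $\bar d_1^k,\dots,\bar d_4^k$ with $$\bar d_1^k+\bar d_4^k\in\partial_Cf(x^{k,r+1})+A^\top y^{k,r+1},\qquad \bar d_2^k\in\partial g(\bar x^{k,r+1})+B^\top y^{k,r+1},$$ $$0=\lambda^k+\beta^kz^{k,r+1}+y^{k,r+1},\qquad \bar d_3^k=Ax^{k,r+1}+B\bar x^{k,r+1}+z^{k,r+1}-b,$$ $\|\bar d_j^k\|\le\epsilon_j^k$ $(j=1,2,3)$ and $\|\bar d_4^k\|\le C_2\,\epsilon_4^k$. -/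

import Mathlib

open Filter Topology Set

namespace TwoLevelADMM

/-! ### Spaces and nonsmooth analysis -/

/-- `ℝⁿ` with the Euclidean norm. -/
abbrev Vec (n : ℕ) := EuclideanSpace ℝ (Fin n)

/-- The space of concatenated vectors `x = (x₁, …, x_N)`, `xᵢ ∈ ℝ^{nᵢ}`, with the Euclidean norm. -/
abbrev BlockVec {N : ℕ} (n : Fin N → ℕ) := PiLp 2 (fun i : Fin N => Vec (n i))

section Nonsmooth

variable {E : Type*} [NormedAddCommGroup E] [InnerProductSpace ℝ E]

/-- Clarke's generalized directional derivative
`h°(x; d) = limsup_{y → x, t ↓ 0} (h (y + t d) - h y) / t`, as an extended real number. -/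
noncomputable def clarkeDeriv (h : E → ℝ) (x d : E) : EReal :=
  limsup (fun w : E × ℝ => (((h (w.1 + w.2 • d) - h w.1) / w.2 : ℝ) : EReal)) (𝓝 x ×ˢ 𝓝[>] 0)

/-- The Clarke generalized subdifferential. -/
def clarkeSubdiff (h : E → ℝ) (x : E) : Set E :=
  {ξ | ∀ d : E, ((inner ℝ ξ d : ℝ) : EReal) ≤ clarkeDeriv h x d}

/-- The subdifferential of convex analysis. -/
def convexSubdiff (h : E → ℝ) (x : E) : Set E :=
  {ξ | ∀ y : E, h x + inner ℝ ξ (y - x) ≤ h y}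

end Nonsmooth

/-! ### The derivative-free trust-region solver for nonsmooth functions -/

/-- The constants `η̄₁, θ̄, ε̄, ζ̄₁, ζ̄₂, ζ̄, p̄` of the solver and the constant `δ` of its model. -/
structure TRParams where
  η₁ : ℝ
  θ : ℝ
  ε : ℝ
  ζ₁ : ℝ
  ζ₂ : ℝ
  ζ : ℝ
  p : ℝ
  δ : ℝ
  η₁_pos : 0 < η₁
  θ_pos : 0 < θ
  ε_pos : 0 < ε
  ζ₁_pos : 0 < ζ₁
  ζ₁_lt_one : ζ₁ < 1
  one_le_ζ₂ : 1 ≤ ζ₂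
  ζ_pos : 0 < ζ
  p_pos : 0 < p
  δ_pos : 0 < δ

/-- The data produced by the solver: at iteration `q`, the iterate `x q`, the radius `Δ q`, the newly
generated direction `dir q`, the sample set `Y q`, the matrix `H q`, the direction set `G q` at the
beginning of the iteration, and the trial step `s q` that is finally used. -/
structure TRRun (n : ℕ) where
  x : ℕ → Vec n
  Δ : ℕ → ℝ
  dir : ℕ → Vec n
  Y : ℕ → Finset (Vec n)
  H : ℕ → Matrix (Fin n) (Fin n) ℝ
  G : ℕ → Finset (Vec n)
  s : ℕ → Vec n

section Solver

variable {n : ℕ}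

/-- The offset `β̃` of the direction `v`:
`max_{y ∈ Y} max {0, h x - h y + ⟪v, y - x⟫ + δ ‖y - x‖²}`. -/
noncomputable def offset (P : TRParams) (h : Vec n → ℝ) (x : Vec n) (Y : Finset (Vec n))
    (v : Vec n) : ℝ :=
  ⨆ y : {y // y ∈ Y}, max 0 (h x - h y.1 + inner ℝ v (y.1 - x) + P.δ * ‖y.1 - x‖ ^ 2)

/-- The feasible set of the trust-region subproblem in the variables `(s, α)`. -/
def trFeasible (P : TRParams) (h : Vec n → ℝ) (x : Vec n) (Δ : ℝ) (G Y : Finset (Vec n)) :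
    Set (Vec n × ℝ) :=
  {w | (∀ v ∈ G, h x - offset P h x Y v + inner ℝ v w.1 ≤ w.2) ∧ ‖w.1‖ ^ 2 ≤ Δ ^ 2}

/-- The objective `½ sᵀ H s + α` of the trust-region subproblem. -/
noncomputable def trObjective (H : Matrix (Fin n) (Fin n) ℝ) (w : Vec n × ℝ) : ℝ :=
  (1 / 2) * inner ℝ w.1 (Matrix.toEuclideanLin H w.1) + w.2

/-- `(s, α)` solves the trust-region subproblem with direction set `G`. -/
def IsTRSolution (P : TRParams) (h : Vec n → ℝ) (x : Vec n) (Δ : ℝ) (G Y : Finset (Vec n))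
    (H : Matrix (Fin n) (Fin n) ℝ) (s : Vec n) (α : ℝ) : Prop :=
  (s, α) ∈ trFeasible P h x Δ G Y ∧ IsMinOn (trObjective H) (trFeasible P h x Δ G Y) (s, α)

/-- `l v`, `v ∈ G`, are Lagrange multipliers at `(s, α)` of the linear constraints of the
trust-region subproblem (`μ` is the multiplier of `‖s‖² ≤ Δ²`): the Karush-Kuhn-Tucker conditions,
in which stationarity in `α` reads `∑ l v = 1`. -/
def AreMultipliers (P : TRParams) (h : Vec n → ℝ) (x : Vec n) (Δ : ℝ) (G Y : Finset (Vec n))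
    (H : Matrix (Fin n) (Fin n) ℝ) (s : Vec n) (α : ℝ) (l : Vec n → ℝ) : Prop :=
  (∀ v ∈ G, 0 ≤ l v) ∧ ∑ v ∈ G, l v = 1 ∧
  (∀ v ∈ G, l v * (h x - offset P h x Y v + inner ℝ v s - α) = 0) ∧
  ∃ μ : ℝ, 0 ≤ μ ∧ μ * (‖s‖ ^ 2 - Δ ^ 2) = 0 ∧
    Matrix.toEuclideanLin H s + ∑ v ∈ G, l v • v + (2 * μ) • s = 0

open scoped Classical in
/-- Iteration `q` of the solver applied to the objective `h`. -/
def TRStep (P : TRParams) (h : Vec n → ℝ) (T : TRRun n) (q : ℕ) : Prop :=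
  -- model construction
  ‖T.dir q‖ = 1 ∧
  (∀ y ∈ T.Y q, ‖y - T.x q‖ ≤ P.ζ * T.Δ q) ∧
  (T.H q).IsSymm ∧
  -- first solution, aggregate direction, criticality test
  (∃ (s₁ : Vec n) (α₁ : ℝ) (l : Vec n → ℝ),
    IsTRSolution P h (T.x q) (T.Δ q) (insert (T.dir q) (T.G q)) (T.Y q) (T.H q) s₁ α₁ ∧
    AreMultipliers P h (T.x q) (T.Δ q) (insert (T.dir q) (T.G q)) (T.Y q) (T.H q) s₁ α₁ l ∧
    (‖∑ v ∈ insert (T.dir q) (T.G q), l v • v‖ < P.ε * T.Δ q ^ (1 / 2 : ℝ) →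
      T.G (q + 1) = {T.dir q} ∧
      ∃ α, IsTRSolution P h (T.x q) (T.Δ q) {T.dir q} (T.Y q) (T.H q) (T.s q) α) ∧
    (¬ ‖∑ v ∈ insert (T.dir q) (T.G q), l v • v‖ < P.ε * T.Δ q ^ (1 / 2 : ℝ) →
      T.G (q + 1) = insert (T.dir q) (T.G q) ∧ T.s q = s₁)) ∧
  -- ratio test and updates
  (P.η₁ ≤ (h (T.x q) - h (T.x q + T.s q)) / (P.θ * ‖T.s q‖ ^ (P.p + 1)) →
    T.x (q + 1) = T.x q + T.s q ∧ T.Δ (q + 1) = P.ζ₂ * T.Δ q) ∧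
  (¬ P.η₁ ≤ (h (T.x q) - h (T.x q + T.s q)) / (P.θ * ‖T.s q‖ ^ (P.p + 1)) →
    T.x (q + 1) = T.x q ∧ T.Δ (q + 1) = P.ζ₁ * T.Δ q)

/-- The solver performs iteration `q`: no radius up to `Δ q` has reached the tolerance. -/
def TRRun.Executes (T : TRRun n) (tol : ℝ) (q : ℕ) : Prop := ∀ q' ≤ q, tol < T.Δ q'

/-- `T` is a run of the solver on the objective `h` started at `x₀` and stopped as soon as the
radius is at most `tol` (nothing is required of `T` after that). -/
structure IsTRRun (P : TRParams) (h : Vec n → ℝ) (x₀ : Vec n) (tol : ℝ) (T : TRRun n) : Prop where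
  start : T.x 0 = x₀
  radius_pos : 0 < T.Δ 0
  directions_empty : T.G 0 = ∅
  step : ∀ q, T.Executes tol q → TRStep P h T q

/-- The run stops after finitely many iterations. -/
def TRRun.Terminates (T : TRRun n) (tol : ℝ) : Prop := ∃ q, T.Δ q ≤ tol

/-- The index `q⋆` at which the run stops (meaningful if the run terminates). -/
noncomputable def TRRun.stopIndex (T : TRRun n) (tol : ℝ) : ℕ := sInf {q | T.Δ q ≤ tol}

/-- Growth condition on the model Hessians:
`λ_max(H^q) ≤ M (Δ^q)^{-ϑ}` and `-λ_min(H^q) ≤ m (Δ^q)^{-ϑ}`. -/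
def HessianGrowth (tol : ℝ) (T : TRRun n) : Prop :=
  ∃ ϑ m M : ℝ, 0 < ϑ ∧ ϑ < 1 / 2 ∧ 0 < m ∧ 0 < M ∧
    ∀ q, T.Executes tol q → ∃ hH : (T.H q).IsHermitian,
      ∀ j, hH.eigenvalues j ≤ M * T.Δ q ^ (-ϑ) ∧ -hH.eigenvalues j ≤ m * T.Δ q ^ (-ϑ)

end Solver

/-! ### The separable problem and the inner loop of the two-level algorithm -/

/-- Data of the problem `min ∑ᵢ fᵢ(xᵢ) + g(x̄)` subject to `∑ᵢ Aᵢ xᵢ + B x̄ = b`. -/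
structure SepProblem {N : ℕ} (n : Fin N → ℕ) (p m : ℕ) where
  f : ∀ i, Vec (n i) → ℝ
  g : Vec p → ℝ
  A : ∀ i, Matrix (Fin m) (Fin (n i)) ℝ
  B : Matrix (Fin m) (Fin p) ℝ
  b : Vec m

/-- The iterates of the inner loop: `x r`, `x̄ r`, `z r`, `y r`, and the run `tr r i` of the
trust-region solver that computes the block `i` of `x (r + 1)`. -/
structure InnerRun {N : ℕ} (n : Fin N → ℕ) (p m : ℕ) where
  x : ℕ → BlockVec n
  xbar : ℕ → Vec p
  z : ℕ → Vec m
  y : ℕ → Vec m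
  tr : ℕ → ∀ i, TRRun (n i)

/-- The inner tolerances `ε₁ᵏ, ε₂ᵏ, ε₃ᵏ, ε₄ᵏ` of an outer iteration and the radius tolerances
`ε₄^{k,r}`, `r = 0, 1, …`. -/
structure Tolerances where
  ε₁ : ℝ
  ε₂ : ℝ
  ε₃ : ℝ
  ε₄ : ℝ
  radius : ℕ → ℝ

section Inner

variable {N p m : ℕ} {n : Fin N → ℕ}

/-- `f(x) = ∑ᵢ fᵢ(xᵢ)`. -/
noncomputable def SepProblem.fsum (S : SepProblem n p m) (x : BlockVec n) : ℝ :=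
  ∑ i, S.f i (x i)

/-- `A x = ∑ᵢ Aᵢ xᵢ`. -/
noncomputable def SepProblem.mulA (S : SepProblem n p m) (x : BlockVec n) : Vec m :=
  ∑ i, Matrix.toEuclideanLin (S.A i) (x i)

/-- `Aᵀ y`, whose blocks are `Aᵢᵀ y`. -/
noncomputable def SepProblem.mulAT (S : SepProblem n p m) (y : Vec m) : BlockVec n :=
  WithLp.toLp 2 (fun i => Matrix.toEuclideanLin (S.A i).transpose y)

/-- `B x̄`. -/
noncomputable def SepProblem.mulB (S : SepProblem n p m) (u : Vec p) : Vec m :=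
  Matrix.toEuclideanLin S.B u

/-- `Bᵀ y`. -/
noncomputable def SepProblem.mulBT (S : SepProblem n p m) (y : Vec m) : Vec p :=
  Matrix.toEuclideanLin S.B.transpose y

/-- The objective of the `i`-th block subproblem; the blocks are updated one after the other, so
those with index `j < i` already have their new values. -/
noncomputable def SepProblem.blockObjective (S : SepProblem n p m) (ρ : ℝ)
    (xnew xold : BlockVec n) (xbar : Vec p) (z y : Vec m) (i : Fin N) (u : Vec (n i)) : ℝ :=
  S.f i u + ρ / 2 * ‖Matrix.toEuclideanLin (S.A i) u
    + ∑ j ∈ Finset.Iio i, Matrix.toEuclideanLin (S.A j) (xnew j)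
    + ∑ j ∈ Finset.Ioi i, Matrix.toEuclideanLin (S.A j) (xold j)
    + S.mulB xbar + z - S.b + ρ⁻¹ • y‖ ^ 2

/-- The objective of the `x`-subproblem in the concatenated variable `x`. -/
noncomputable def SepProblem.xObjective (S : SepProblem n p m) (ρ : ℝ)
    (xbar : Vec p) (z y : Vec m) (x : BlockVec n) : ℝ :=
  S.fsum x + ρ / 2 * ‖S.mulA x + S.mulB xbar + z - S.b + ρ⁻¹ • y‖ ^ 2

/-- The objective `g(x̄) + (ρ/2) ‖B x̄ + v‖²` of the `x̄`-subproblem. -/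
noncomputable def SepProblem.xbarObjective (S : SepProblem n p m) (ρ : ℝ) (v : Vec m)
    (u : Vec p) : ℝ :=
  S.g u + ρ / 2 * ‖S.mulB u + v‖ ^ 2

/-- The radius `Δ^{k,r+1}` at termination: the largest of the final radii of the block solvers. -/
noncomputable def InnerRun.finalRadius (R : InnerRun n p m) (tol : Tolerances) (r : ℕ) : ℝ :=
  ⨆ i : Fin N, (R.tr r i).Δ ((R.tr r i).stopIndex (tol.radius r))

/-- The stopping criterion of the inner loop, tested after the update that produces the iterate of
index `r + 1`. -/
def InnerRun.Stop (R : InnerRun n p m) (S : SepProblem n p m) (ρ : ℝ) (tol : Tolerances)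
    (r : ℕ) : Prop :=
  ‖ρ • S.mulAT (S.mulB (R.xbar (r + 1)) + R.z (r + 1) - S.mulB (R.xbar r) - R.z r)‖ ≤ tol.ε₁ ∧
  ‖ρ • S.mulBT (R.z (r + 1) - R.z r)‖ ≤ tol.ε₂ ∧
  ‖S.mulA (R.x (r + 1)) + S.mulB (R.xbar (r + 1)) + R.z (r + 1) - S.b‖ ≤ tol.ε₃ ∧
  R.finalRadius tol r ≤ tol.radius r ∧ tol.radius r ≤ tol.ε₄

/-- The inner loop performs the iteration that produces the iterate of index `r + 1`: its stopping
criterion did not hold before. -/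
def InnerRun.Reaches (R : InnerRun n p m) (S : SepProblem n p m) (ρ : ℝ) (tol : Tolerances)
    (r : ℕ) : Prop :=
  ∀ r' < r, ¬ R.Stop S ρ tol r'

/-- `R` is a run of the inner loop with multiplier `lam`, penalties `β`, `ρ` and solution map `G` of
the `x̄`-subproblem, stopped as soon as the stopping criterion holds (nothing is required of `R`
after that). The block solvers are started at the current block. -/
structure IsInnerRun (S : SepProblem n p m) (P : TRParams) (G : Vec m → Vec p) (lam : Vec m)
    (β ρ : ℝ) (tol : Tolerances) (R : InnerRun n p m) : Prop where
  init : lam + β • R.z 0 + R.y 0 = 0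
  solver : ∀ r, R.Reaches S ρ tol r → ∀ i,
    IsTRRun P (S.blockObjective ρ (R.x (r + 1)) (R.x r) (R.xbar r) (R.z r) (R.y r) i)
      (R.x r i) (tol.radius r) (R.tr r i)
  x_update : ∀ r, R.Reaches S ρ tol r → ∀ i,
    R.x (r + 1) i = (R.tr r i).x ((R.tr r i).stopIndex (tol.radius r))
  xbar_update : ∀ r, R.Reaches S ρ tol r →
    R.xbar (r + 1) = G (S.mulA (R.x (r + 1)) + R.z r - S.b + ρ⁻¹ • R.y r)
  z_update : ∀ r, R.Reaches S ρ tol r →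
    R.z (r + 1) =
      -(ρ / (ρ + β)) • (S.mulA (R.x (r + 1)) + S.mulB (R.xbar (r + 1)) + ρ⁻¹ • R.y r - S.b)
        - (1 / (ρ + β)) • lam
  y_update : ∀ r, R.Reaches S ρ tol r →
    R.y (r + 1) =
      R.y r + ρ • (S.mulA (R.x (r + 1)) + S.mulB (R.xbar (r + 1)) + R.z (r + 1) - S.b)

end Inner

end TwoLevelADMM

namespace TwoLevelADMM

/-! Both loops stop for the same reason: a quantity that is bounded below never increases, so its
decrements tend to zero.

Solver: while the radius exceeds `tol`, the model Hessians are uniformly bounded and the direction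
being used has norm bounded below. A step inside the trust region satisfies `H s + u = 0`, so steps
cannot be short (`exists_step_norm_lower_bound`). An accepted step therefore lowers the objective by
a fixed amount, which can happen only finitely often; after that every iteration shrinks the radius
geometrically.

Inner loop: the updates preserve `lam + β z + y = 0`. Under this relation the augmented Lagrangian
is bounded below (`slackLagrangian_ge`) and drops by at least `β‖BΔx̄‖² + β‖Δz‖²` per iteration
(`IsInnerRun.lagrangian_descent`). Hence `BΔx̄` and `Δz` tend to zero, and so does the residual,
which equals `-Δz/2`.

At the stopping index, optimality in `x̄` and the Clarke sum rule for `f` plus a smooth penalty are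
rewritten with the new multiplier; the stopping quantities are exactly the leftover terms. -/

lemma nonpos_of_eventually_le_mul {a b : ℝ} (h : ∀ᶠ t in 𝓝[>] (0 : ℝ), a ≤ t * b) : a ≤ 0 := by
  have hlim : Tendsto (fun t : ℝ => t * b) (𝓝[>] 0) (𝓝 0) := by
    have : Tendsto (fun t : ℝ => t * b) (𝓝 0) (𝓝 (0 * b)) :=
      (continuous_id.mul continuous_const).tendsto 0
    rw [zero_mul] at this
    exact this.mono_left nhdsWithin_le_nhds
  exact ge_of_tendsto hlim h

/-- An antitone sequence bounded below has increments that tend to zero. -/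
lemma tendsto_sub_succ_of_antitone {a : ℕ → ℝ} (ha : Antitone a) (hb : BddBelow (range a)) :
    Tendsto (fun q => a q - a (q + 1)) atTop (𝓝 0) := by
  have h := tendsto_atTop_ciInf ha hb
  have h' := h.sub ((tendsto_add_atTop_iff_nat 1).2 h)
  rwa [sub_self] at h'

/-! ### Transposes and spectral norm bounds -/

section Matrices

variable {n m : ℕ}

lemma inner_toEuclideanLin_transpose (A : Matrix (Fin m) (Fin n) ℝ) (y : Vec m) (x : Vec n) :
    inner ℝ (Matrix.toEuclideanLin A.transpose y) x = inner ℝ y (Matrix.toEuclideanLin A x) := by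
  have h := Matrix.toEuclideanLin_conjTranspose_eq_adjoint A
  rw [Matrix.conjTranspose_eq_transpose_of_trivial] at h
  rw [h, LinearMap.adjoint_inner_left]

/-- Parseval in an orthonormal eigenbasis: each coordinate is multiplied by its eigenvalue. -/
lemma norm_toEuclideanLin_le {H : Matrix (Fin n) (Fin n) ℝ} (hH : H.IsHermitian) {C : ℝ}
    (hC : 0 ≤ C) (h : ∀ j, |hH.eigenvalues j| ≤ C) (s : Vec n) :
    ‖Matrix.toEuclideanLin H s‖ ≤ C * ‖s‖ := by
  have hT : H.transpose = H := by
    have := hH.eq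
    rwa [Matrix.conjTranspose_eq_transpose_of_trivial] at this
  have key : ∀ j, inner ℝ (hH.eigenvectorBasis j) (Matrix.toEuclideanLin H s)
      = hH.eigenvalues j * inner ℝ (hH.eigenvectorBasis j) s := by
    intro j
    rw [← inner_toEuclideanLin_transpose, hT]
    have : Matrix.toEuclideanLin H (hH.eigenvectorBasis j)
        = hH.eigenvalues j • hH.eigenvectorBasis j := by
      apply (WithLp.ofLp_injective 2)
      exact hH.mulVec_eigenvectorBasis j
    rw [this, real_inner_smul_left]
  refine abs_le_of_sq_le_sq' ?_ (by positivity) |>.2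
  rw [mul_pow, ← hH.eigenvectorBasis.sum_sq_norm_inner_right s,
    ← hH.eigenvectorBasis.sum_sq_norm_inner_right, Finset.mul_sum]
  refine Finset.sum_le_sum fun j _ => ?_
  rw [key, norm_mul, mul_pow]
  gcongr
  exact h j

end Matrices

/-! ### Finite termination and monotonicity of the trust-region solver -/

section Solver

variable {n : ℕ} {P : TRParams} {h : Vec n → ℝ} {x₀ : Vec n} {tol : ℝ} {T : TRRun n} {q : ℕ}

/-- A solution of the trust-region subproblem with a single direction that lies in the interior of
the trust region is stationary. -/
lemma IsTRSolution.stationary_of_singleton {x g s : Vec n} {Δ α : ℝ} {Y : Finset (Vec n)}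
    {H : Matrix (Fin n) (Fin n) ℝ} (hH : H.IsSymm) (hs : IsTRSolution P h x Δ {g} Y H s α)
    (hΔ : ‖s‖ < Δ) : Matrix.toEuclideanLin H s + g = 0 := by
  obtain ⟨⟨hfeas, -⟩, hmin⟩ := hs
  have hα := hfeas g (Finset.mem_singleton_self g)
  set e := Matrix.toEuclideanLin H s + g with he
  have hball : ∀ᶠ t in 𝓝[>] (0 : ℝ), ‖s - t • e‖ < Δ := by
    have hc : ContinuousAt (fun t : ℝ => ‖s - t • e‖) 0 := by fun_prop
    have := hc.eventually_lt (continuousAt_const (y := Δ)) (by simpa using hΔ)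
    exact this.filter_mono nhdsWithin_le_nhds
  have hsq : ‖e‖ ^ 2 ≤ 0 := by
    -- Moving from `s` to `s - t e`, with `α` lowered to its constraint value, changes the objective
    -- by at most `-t‖e‖² + t²⟪e, He⟫/2`. Minimality and `t → 0` force `e = 0`.
    refine nonpos_of_eventually_le_mul (b := (1 / 2) * inner ℝ e (Matrix.toEuclideanLin H e)) ?_
    filter_upwards [hball, self_mem_nhdsWithin] with t ht htpos
    have htpos : 0 < t := htpos
    have hw := hmin (show (s - t • e, h x - offset P h x Y g + inner ℝ g (s - t • e)) ∈
        trFeasible P h x Δ {g} Y from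
      ⟨fun v hv => by rw [Finset.mem_singleton.1 hv], by
        have := norm_nonneg (s - t • e)
        show ‖s - t • e‖ ^ 2 ≤ Δ ^ 2
        gcongr⟩)
    simp only [mem_ofPred_eq, trObjective] at hw
    have hsym : inner ℝ s (Matrix.toEuclideanLin H e) = inner ℝ e (Matrix.toEuclideanLin H s) := by
      rw [← inner_toEuclideanLin_transpose, hH.eq, real_inner_comm]
    have hee : inner ℝ e (Matrix.toEuclideanLin H s) + inner ℝ g e = ‖e‖ ^ 2 := by
      rw [real_inner_comm e g, ← inner_add_right, ← he, real_inner_self_eq_norm_sq]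
    simp only [map_sub, map_smul, inner_sub_left, inner_sub_right, real_inner_smul_left,
      real_inner_smul_right, hsym] at hw
    have : 0 ≤ t * (t * ((1 / 2) * inner ℝ e (Matrix.toEuclideanLin H e)) - ‖e‖ ^ 2) := by
      rw [← hee]; nlinarith
    have := nonneg_of_mul_nonneg_right this htpos
    linarith
  have : ‖e‖ = 0 := by nlinarith [norm_nonneg e]
  exact norm_eq_zero.1 this

/-- The steps used by the solver are bounded away from zero as long as it has not stopped. -/
lemma exists_step_norm_lower_bound (htol : 0 < tol)
    (hstep : ∀ q, T.Executes tol q → TRStep P h T q) (hH : HessianGrowth tol T) :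
    ∃ c, 0 < c ∧ ∀ q, T.Executes tol q → c ≤ ‖T.s q‖ := by
  classical
  obtain ⟨ϑ, m, M, hϑ, -, hm, hM, hgrow⟩ := hH
  -- A negative power is largest at the smallest radius, so `tol` gives a bound uniform in `q`.
  set K := max m M * tol ^ (-ϑ) with hK
  have hmax : 0 < max m M := lt_max_of_lt_left hm
  have hKpos : 0 < K := mul_pos hmax (Real.rpow_pos_of_pos htol _)
  -- After a reset the only direction has norm 1; otherwise the failed criticality test bounds the
  -- aggregate from below.
  set e := min 1 (P.ε * tol ^ (1 / 2 : ℝ)) with he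
  have hepos : 0 < e := lt_min one_pos (mul_pos P.ε_pos (Real.rpow_pos_of_pos htol _))
  refine ⟨min tol (e / K), lt_min htol (div_pos hepos hKpos), fun q hq => ?_⟩
  have hΔ : tol < T.Δ q := hq q le_rfl
  have hΔ0 : 0 < T.Δ q := htol.trans hΔ
  obtain ⟨hherm, heig⟩ := hgrow q hq
  have hpow : T.Δ q ^ (-ϑ) ≤ tol ^ (-ϑ) :=
    Real.rpow_le_rpow_of_nonpos htol hΔ.le (by linarith)
  have hnorm : ∀ s, ‖Matrix.toEuclideanLin (T.H q) s‖ ≤ K * ‖s‖ := by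
    refine norm_toEuclideanLin_le hherm hKpos.le fun j => abs_le.2 ⟨?_, ?_⟩
    · have h1 : m * T.Δ q ^ (-ϑ) ≤ K := by
        rw [hK]; gcongr; exact le_max_left _ _
      linarith [(heig j).2]
    · have h1 : M * T.Δ q ^ (-ϑ) ≤ K := by
        rw [hK]; gcongr; exact le_max_right _ _
      linarith [(heig j).1]
  have hfinish : ∀ u, e ≤ ‖u‖ → Matrix.toEuclideanLin (T.H q) (T.s q) + u = 0 →
      min tol (e / K) ≤ ‖T.s q‖ := by
    intro u hu h0
    refine (min_le_right _ _).trans ((div_le_iff₀' hKpos).2 ?_)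
    refine hu.trans (le_trans (le_of_eq ?_) (hnorm _))
    rw [eq_neg_of_add_eq_zero_left h0, norm_neg]
  obtain ⟨hdir, -, hsymm, ⟨s₁, α₁, l, hsol, hmult, hreset, hkeep⟩, -, -⟩ := hstep q hq
  by_cases hcrit : ‖∑ v ∈ insert (T.dir q) (T.G q), l v • v‖ < P.ε * T.Δ q ^ (1 / 2 : ℝ)
  · obtain ⟨-, α, hα⟩ := hreset hcrit
    by_cases hint : ‖T.s q‖ < T.Δ q
    · exact hfinish (T.dir q) (by rw [hdir]; exact min_le_left _ _)
        (hα.stationary_of_singleton hsymm hint)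
    · exact (min_le_left _ _).trans (hΔ.le.trans (not_lt.1 hint))
  · obtain ⟨-, hs⟩ := hkeep hcrit
    by_cases hint : ‖T.s q‖ < T.Δ q
    · obtain ⟨-, -, -, μ, -, hμ, hstat⟩ := hmult
      rw [← hs] at hμ hstat
      have hμ0 : μ = 0 := by
        rcases mul_eq_zero.1 hμ with h | h
        · exact h
        · nlinarith [norm_nonneg (T.s q)]
      rw [hμ0, mul_zero, zero_smul, add_zero] at hstat
      refine hfinish _ (le_trans ?_ (not_lt.1 hcrit)) hstat
      refine (min_le_right _ _).trans ?_
      have := P.ε_pos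
      gcongr
    · exact (min_le_left _ _).trans (hΔ.le.trans (not_lt.1 hint))

/-- An acceptance ratio of at least `η₁ > 0` excludes an increase. A zero step gives `0` by the
convention for division by zero, hence is rejected. -/
lemma TRStep.le (hs : TRStep P h T q) : h (T.x (q + 1)) ≤ h (T.x q) := by
  obtain ⟨-, -, -, -, hsucc, hfail⟩ := hs
  by_cases hr : P.η₁ ≤ (h (T.x q) - h (T.x q + T.s q)) / (P.θ * ‖T.s q‖ ^ (P.p + 1))
  · rw [(hsucc hr).1]
    by_contra! hlt
    have hden : 0 ≤ P.θ * ‖T.s q‖ ^ (P.p + 1) :=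
      mul_nonneg P.θ_pos.le (Real.rpow_nonneg (norm_nonneg _) _)
    have := div_nonpos_of_nonpos_of_nonneg (sub_nonpos.2 hlt.le) hden
    linarith [P.η₁_pos]
  · rw [(hfail hr).1]

lemma TRStep.decrease_or_shrink (hs : TRStep P h T q) {c : ℝ} (hc : 0 < c) (hcs : c ≤ ‖T.s q‖) :
    P.η₁ * (P.θ * c ^ (P.p + 1)) ≤ h (T.x q) - h (T.x (q + 1)) ∨
      T.Δ (q + 1) = P.ζ₁ * T.Δ q := by
  obtain ⟨-, -, -, -, hsucc, hfail⟩ := hs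
  by_cases hr : P.η₁ ≤ (h (T.x q) - h (T.x q + T.s q)) / (P.θ * ‖T.s q‖ ^ (P.p + 1))
  · left
    rw [(hsucc hr).1]
    have hη := P.η₁_pos
    have hθ := P.θ_pos
    have hp := P.p_pos
    have hpow : c ^ (P.p + 1) ≤ ‖T.s q‖ ^ (P.p + 1) := by gcongr
    have hpos : 0 < ‖T.s q‖ ^ (P.p + 1) := (Real.rpow_pos_of_pos hc _).trans_le hpow
    rw [le_div_iff₀ (mul_pos hθ hpos)] at hr
    refine le_trans ?_ hr
    gcongr
  · exact Or.inr (hfail hr).2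

/-- Finite termination of the solver. -/
lemma IsTRRun.terminates (hT : IsTRRun P h x₀ tol T) (htol : 0 < tol)
    (hb : BddBelow (range h)) (hH : HessianGrowth tol T) : T.Terminates tol := by
  by_contra hnot
  have hΔ : ∀ q, tol < T.Δ q := fun q => not_le.1 fun hq => hnot ⟨q, hq⟩
  have hex : ∀ q, T.Executes tol q := fun q q' _ => hΔ q'
  obtain ⟨c, hc, hcs⟩ := exists_step_norm_lower_bound htol hT.step hH
  have hlim := tendsto_sub_succ_of_antitone (a := fun q => h (T.x q))
    (antitone_nat_of_succ_le fun q => (hT.step q (hex q)).le)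
    (hb.mono (range_comp_subset_range T.x h))
  have hκ : 0 < P.η₁ * (P.θ * c ^ (P.p + 1)) :=
    mul_pos P.η₁_pos (mul_pos P.θ_pos (Real.rpow_pos_of_pos hc _))
  -- From `Q` on, the decrease is below what an accepted step would produce, so every iteration is a
  -- rejection.
  obtain ⟨Q, hQ⟩ := eventually_atTop.1 (hlim.eventually_lt_const hκ)
  have hshrink : ∀ k, T.Δ (Q + k) = P.ζ₁ ^ k * T.Δ Q := by
    intro k
    induction k with
    | zero => simp
    | succ k ih =>
      rcases (hT.step _ (hex (Q + k))).decrease_or_shrink hc (hcs _ (hex _)) with h1 | h1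
      · exact absurd (hQ (Q + k) (Nat.le_add_right _ _)) (not_lt.2 h1)
      · rw [← add_assoc, h1, ih]; ring
  have hgeo : Tendsto (fun k => P.ζ₁ ^ k * T.Δ Q) atTop (𝓝 (0 * T.Δ Q)) :=
    (tendsto_pow_atTop_nhds_zero_of_lt_one P.ζ₁_pos.le P.ζ₁_lt_one).mul_const _
  rw [zero_mul] at hgeo
  have := ge_of_tendsto' hgeo fun k => ((hΔ (Q + k)).trans_eq (hshrink k)).le
  linarith

lemma TRRun.Terminates.stopIndex_le (hT : T.Terminates tol) : T.Δ (T.stopIndex tol) ≤ tol :=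
  Nat.sInf_mem hT

/-- The solver does not increase the objective. -/
lemma IsTRRun.apply_stop_le (hT : IsTRRun P h x₀ tol T) :
    h (T.x (T.stopIndex tol)) ≤ h x₀ := by
  -- Termination is not needed: without it `stopIndex` is `sInf ∅ = 0`, the starting index.
  have : ∀ q ≤ T.stopIndex tol, h (T.x q) ≤ h x₀ := by
    intro q
    induction q with
    | zero => intro _; rw [hT.start]
    | succ q ih =>
      intro hq
      refine (hT.step q fun q' hq' => not_le.1 fun hle => ?_).le.trans (ih (by omega))
      have : T.stopIndex tol ≤ q' := Nat.sInf_le hle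
      omega
  exact this _ le_rfl

end Solver

/-! ### Clarke sum rule and convex first-order conditions -/

section Nonsmooth

variable {E F : Type*} [NormedAddCommGroup E] [InnerProductSpace ℝ E]
  [NormedAddCommGroup F] [InnerProductSpace ℝ F]

/-- An intersection of closed conditions, one for each direction. -/
lemma isClosed_clarkeSubdiff (h : E → ℝ) (x : E) : IsClosed (clarkeSubdiff h x) := by
  have : clarkeSubdiff h x = ⋂ d : E, {ξ | ((inner ℝ ξ d : ℝ) : EReal) ≤ clarkeDeriv h x d} := by
    ext ξ; simp [clarkeSubdiff]
  rw [this]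
  refine isClosed_iInter fun d => isClosed_le ?_ continuous_const
  exact continuous_coe_real_ereal.comp (by fun_prop)

/-- Sum rule for a summand that has the strict derivative `v` along every direction. -/
lemma sub_mem_clarkeSubdiff {f q : E → ℝ} {x v ξ : E}
    (hq : ∀ d : E, Tendsto (fun w : E × ℝ => (q (w.1 + w.2 • d) - q w.1) / w.2)
      (𝓝 x ×ˢ 𝓝[>] 0) (𝓝 (inner ℝ v d)))
    (hξ : ξ ∈ clarkeSubdiff (fun y => f y + q y) x) : ξ - v ∈ clarkeSubdiff f x := by
  intro d
  have hlim : limsup (fun w : E × ℝ => (((q (w.1 + w.2 • d) - q w.1) / w.2 : ℝ) : EReal))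
      (𝓝 x ×ˢ 𝓝[>] 0) = ((inner ℝ v d : ℝ) : EReal) :=
    ((continuous_coe_real_ereal.tendsto _).comp (hq d)).limsup_eq
  have hsplit : clarkeDeriv (fun y => f y + q y) x d ≤
      clarkeDeriv f x d + ((inner ℝ v d : ℝ) : EReal) := by
    rw [← hlim]
    -- Subadditivity of limsup in `EReal` must exclude `∞ - ∞`; the smooth summand has a real limit.
    refine le_trans (le_of_eq ?_) (EReal.limsup_add_le
      (.inr (by rw [hlim]; exact EReal.coe_ne_top _))
      (.inr (by rw [hlim]; exact EReal.coe_ne_bot _)))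
    refine limsup_congr (Eventually.of_forall fun w => ?_)
    rw [Pi.add_apply, ← EReal.coe_add, ← add_div]
    congr 2
    ring
  have h := (hξ d).trans hsplit
  rw [inner_sub_left, EReal.coe_sub]
  exact EReal.sub_le_of_le_add h

/-- For positive step the quotient equals an expression that is jointly continuous up to step zero.
-/
lemma tendsto_diffQuot_sq_norm (A : E →L[ℝ] F) (c : F) (ρ : ℝ) (x d : E) :
    Tendsto (fun w : E × ℝ =>
      (ρ / 2 * ‖A (w.1 + w.2 • d) + c‖ ^ 2 - ρ / 2 * ‖A w.1 + c‖ ^ 2) / w.2)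
      (𝓝 x ×ˢ 𝓝[>] 0) (𝓝 (ρ * inner ℝ (A x + c) (A d))) := by
  have hc : Continuous fun w : E × ℝ =>
      ρ * inner ℝ (A w.1 + c) (A d) + w.2 * (ρ / 2 * ‖A d‖ ^ 2) := by fun_prop
  have hlim := hc.tendsto (x, 0)
  rw [nhds_prod_eq] at hlim
  simp only [zero_mul, add_zero] at hlim
  refine (hlim.mono_left (prod_mono le_rfl nhdsWithin_le_nhds)).congr' ?_
  have hpos : ∀ᶠ w : E × ℝ in 𝓝 x ×ˢ 𝓝[>] 0, w.2 ∈ Ioi (0 : ℝ) :=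
    tendsto_snd.eventually self_mem_nhdsWithin
  filter_upwards [hpos] with w hw
  have hw0 : w.2 ≠ 0 := ne_of_gt hw
  have : A (w.1 + w.2 • d) + c = (A w.1 + c) + w.2 • A d := by
    rw [map_add, map_smul]; abel
  rw [this, norm_add_sq_real, real_inner_smul_right, norm_smul, mul_pow, Real.norm_eq_abs, sq_abs]
  field_simp
  ring

/-- First-order optimality for the sum of a convex function and a least-squares term. -/
lemma le_of_isMinOn_add_sq_norm {g : E → ℝ} (hg : ConvexOn ℝ univ g) (B : E →ₗ[ℝ] F) {v : F}
    {ρ : ℝ} {u : E} (hu : IsMinOn (fun y => g y + ρ / 2 * ‖B y + v‖ ^ 2) univ u) (y : E) :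
    g u - ρ * inner ℝ (B u + v) (B (y - u)) ≤ g y := by
  suffices h : g u - ρ * inner ℝ (B u + v) (B (y - u)) - g y ≤ 0 by linarith
  -- Compare `u` with `u + t (y - u)`: convexity bounds `g` there, and after division by `t` only
  -- the quadratic term carries a factor `t`.
  refine nonpos_of_eventually_le_mul (b := ρ / 2 * ‖B (y - u)‖ ^ 2) ?_
  filter_upwards [Ioo_mem_nhdsGT one_pos] with t ht
  have hmin := hu (mem_univ (u + t • (y - u)))
  simp only [mem_ofPred_eq] at hmin
  have hconv := hg.2 (mem_univ u) (mem_univ y) (sub_nonneg.2 ht.2.le) ht.1.le (by ring)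
  have hpt : (1 - t) • u + t • y = u + t • (y - u) := by
    rw [sub_smul, smul_sub, one_smul]; abel
  rw [hpt, smul_eq_mul, smul_eq_mul] at hconv
  have hB : B (u + t • (y - u)) + v = (B u + v) + t • B (y - u) := by
    rw [map_add, map_smul]; abel
  rw [hB, norm_add_sq_real (B u + v) (t • _), real_inner_smul_right, norm_smul, mul_pow,
    Real.norm_eq_abs, sq_abs] at hmin
  have : 0 ≤ t * (t * (ρ / 2 * ‖B (y - u)‖ ^ 2)
      - (g u - ρ * inner ℝ (B u + v) (B (y - u)) - g y)) := by
    nlinarith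
  linarith [nonneg_of_mul_nonneg_right this ht.1]

/-- Descent at a minimizer of the sum of a convex function and a least-squares term. -/
lemma add_sq_norm_add_le_of_isMinOn {g : E → ℝ} (hg : ConvexOn ℝ univ g) (B : E →ₗ[ℝ] F) {v : F}
    {ρ : ℝ} {u : E} (hu : IsMinOn (fun y => g y + ρ / 2 * ‖B y + v‖ ^ 2) univ u) (y : E) :
    g u + ρ / 2 * ‖B u + v‖ ^ 2 + ρ / 2 * ‖B u - B y‖ ^ 2 ≤ g y + ρ / 2 * ‖B y + v‖ ^ 2 := by
  have h := le_of_isMinOn_add_sq_norm hg B hu y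
  have hy : B y + v = (B u + v) + B (y - u) := by rw [map_sub]; abel
  have hn : ‖B u - B y‖ = ‖B (y - u)‖ := by rw [map_sub, norm_sub_rev]
  rw [hy, hn, norm_add_sq_real (B u + v) (B (y - u))]
  linarith

end Nonsmooth

/-! ### Algebra of the slack and multiplier updates -/

section Multipliers

variable {F : Type*} [NormedAddCommGroup F] [InnerProductSpace ℝ F]

/-- The part of the augmented Lagrangian that depends on the residual `c = A x + B x̄ - b`, the
slack `z` and the multiplier `y`. -/
noncomputable def slackLagrangian (lam : F) (β : ℝ) (c z y : F) : ℝ :=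
  inner ℝ lam z + β / 2 * ‖z‖ ^ 2 + β * ‖c + z‖ ^ 2 + inner ℝ (c + z) y

/-- Completing the square with `ρ = 2β` exposes the penalty of the subproblems; the other terms are
constant while `z` and `y` are fixed. -/
lemma slackLagrangian_eq (lam : F) {β : ℝ} (hβ : 0 < β) (c z y : F) :
    slackLagrangian lam β c z y = inner ℝ lam z + β / 2 * ‖z‖ ^ 2
      + β * ‖c + z + (2 * β)⁻¹ • y‖ ^ 2 - 1 / (4 * β) * ‖y‖ ^ 2 := by
  rw [slackLagrangian, norm_add_sq_real (c + z), real_inner_smul_right, norm_smul, mul_pow,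
    Real.norm_eq_abs, sq_abs]
  field_simp
  ring

lemma slackLagrangian_ge {lam : F} {β : ℝ} (hβ : 0 < β) {c z y : F}
    (hy : lam + β • z + y = 0) : -(1 / (2 * β) * ‖lam‖ ^ 2) ≤ slackLagrangian lam β c z y := by
  have hy' : y = -(lam + β • z) := eq_neg_of_add_eq_zero_right hy
  obtain ⟨w, rfl⟩ : ∃ w, c = w - z := ⟨c + z, by abel⟩
  -- Once `y` is eliminated, the quadratic in `z` and `w = c + z` is a sum of two squares up to a
  -- constant.
  have h1 : slackLagrangian lam β (w - z) z y + 1 / (2 * β) * ‖lam‖ ^ 2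
      = β / 2 * ‖w‖ ^ 2 + β / 2 * ‖(z - w) + β⁻¹ • lam‖ ^ 2 := by
    rw [slackLagrangian, hy', sub_add_cancel]
    simp only [← real_inner_self_eq_norm_sq, inner_add_left, inner_add_right, inner_sub_left,
      inner_sub_right, real_inner_smul_left, real_inner_smul_right, inner_neg_right]
    rw [real_inner_comm w z, real_inner_comm w lam, real_inner_comm z lam]
    field_simp
    ring
  have : 0 ≤ β / 2 * ‖w‖ ^ 2 + β / 2 * ‖(z - w) + β⁻¹ • lam‖ ^ 2 := by positivity
  linarith

variable {lam c z y z' y' : F} {β : ℝ}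

/-- The `z`-update is stationarity of the Lagrangian in `z`; inserting the multiplier update turns
it into this relation. -/
lemma multiplier_update (hβ : 0 < β)
    (hz : z' = -(2 * β / (2 * β + β)) • (c + (2 * β)⁻¹ • y) - (1 / (2 * β + β)) • lam)
    (hy : y' = y + (2 * β) • (c + z')) : lam + β • z' + y' = 0 := by
  rw [hy, hz]
  match_scalars <;> (field_simp; ring)

lemma slackLagrangian_update (hβ : 0 < β) (h : lam + β • z + y = 0) (h' : lam + β • z' + y' = 0)
    (hy : y' = y + (2 * β) • (c + z')) :
    slackLagrangian lam β c z' y' + β * ‖z' - z‖ ^ 2 = slackLagrangian lam β c z y := by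
  obtain ⟨d, rfl⟩ : ∃ d, z' = z + d := ⟨z' - z, by abel⟩
  have hyz : y = -(lam + β • z) := eq_neg_of_add_eq_zero_right h
  have hyz' : y' = -(lam + β • (z + d)) := eq_neg_of_add_eq_zero_right h'
  -- Subtracting the two relations gives `y' - y = -β d`, so `c + z' = -d/2`. Everything is then a
  -- function of `z`, `d` and `lam`.
  have hc : c = -(3 / 2 : ℝ) • d - z := by
    have h2 : (2 * β) • (c + (z + d)) = -(β • d) := by
      rw [eq_sub_of_add_eq' hy.symm, hyz, hyz', smul_add]; abel
    have h3 : c + (z + d) = (2 * β)⁻¹ • (-(β • d)) := by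
      rw [← h2, smul_smul, inv_mul_cancel₀ (by positivity), one_smul]
    rw [eq_sub_of_add_eq h3]
    match_scalars <;> field_simp
    ring
  rw [slackLagrangian, slackLagrangian, hyz, hyz', hc]
  simp only [← real_inner_self_eq_norm_sq, inner_add_left, inner_add_right, inner_sub_left,
    inner_sub_right, real_inner_smul_left, real_inner_smul_right, inner_neg_right]
  rw [real_inner_comm d z, real_inner_comm d lam, real_inner_comm z lam]
  ring

end Multipliers

/-! ### Block structure of the `x`-subproblem -/

lemma sum_eq_add_sum_Iio_add_sum_Ioi {N : ℕ} {M : Type*} [AddCommMonoid M] (F : Fin N → M)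
    (i : Fin N) : ∑ j, F j = F i + ∑ j ∈ Finset.Iio i, F j + ∑ j ∈ Finset.Ioi i, F j := by
  have hu : (Finset.univ : Finset (Fin N)) = insert i (Finset.Iio i ∪ Finset.Ioi i) := by
    ext j
    simp only [Finset.mem_univ, Finset.mem_insert, Finset.mem_union, Finset.mem_Iio,
      Finset.mem_Ioi, true_iff]
    rcases lt_trichotomy j i with h | h | h <;> simp [h]
  rw [hu, Finset.sum_insert (by simp), Finset.sum_union, add_assoc]
  rw [Finset.disjoint_left]
  intro j hj hj'
  exact lt_asymm (Finset.mem_Iio.1 hj) (Finset.mem_Ioi.1 hj')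

section Inner

variable {N p m : ℕ} {n : Fin N → ℕ} (S : SepProblem n p m)

lemma SepProblem.inner_mulAT (y : Vec m) (x : BlockVec n) :
    inner ℝ (S.mulAT y) x = inner ℝ y (S.mulA x) := by
  rw [PiLp.inner_apply, SepProblem.mulA, inner_sum]
  exact Finset.sum_congr rfl fun i _ => inner_toEuclideanLin_transpose _ _ _

lemma SepProblem.inner_mulBT (y : Vec m) (x : Vec p) :
    inner ℝ (S.mulBT y) x = inner ℝ y (S.mulB x) :=
  inner_toEuclideanLin_transpose _ _ _

/-- `x ↦ A x` as a continuous linear map. -/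
noncomputable def SepProblem.mulAL : BlockVec n →L[ℝ] Vec m :=
  ∑ i, (Matrix.toEuclideanLin (S.A i)).toContinuousLinearMap ∘L
    PiLp.proj 2 (fun i : Fin N => Vec (n i)) i

lemma SepProblem.mulAL_apply (x : BlockVec n) : S.mulAL x = S.mulA x := by
  simp [SepProblem.mulAL, SepProblem.mulA]

/-- `y ↦ Aᵀ y` as a linear map. -/
noncomputable def SepProblem.mulATL : Vec m →ₗ[ℝ] BlockVec n where
  toFun := S.mulAT
  map_add' y y' := by ext i : 1; simp [SepProblem.mulAT]
  map_smul' c y := by ext i : 1; simp [SepProblem.mulAT]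

/-- `y ↦ Bᵀ y` as a linear map. -/
noncomputable def SepProblem.mulBTL : Vec m →ₗ[ℝ] Vec p := Matrix.toEuclideanLin S.B.transpose

variable {S} {ρ : ℝ} {xbar : Vec p} {z y : Vec m} {x x' : BlockVec n}

/-- The added constant does not involve block `i`, so a change in the block objective is the same
change in the full objective. -/
lemma SepProblem.xObjective_eq_blockObjective_add {i : Fin N} {w : BlockVec n}
    (hlt : ∀ j < i, w j = x' j) (hgt : ∀ j, i < j → w j = x j) :
    S.xObjective ρ xbar z y w = S.blockObjective ρ x' x xbar z y i (w i)
      + (∑ j ∈ Finset.Iio i, S.f j (x' j) + ∑ j ∈ Finset.Ioi i, S.f j (x j)) := by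
  have hA : S.mulA w = Matrix.toEuclideanLin (S.A i) (w i)
      + ∑ j ∈ Finset.Iio i, Matrix.toEuclideanLin (S.A j) (x' j)
      + ∑ j ∈ Finset.Ioi i, Matrix.toEuclideanLin (S.A j) (x j) := by
    rw [SepProblem.mulA, sum_eq_add_sum_Iio_add_sum_Ioi _ i]
    congr 1
    · congr 1
      exact Finset.sum_congr rfl fun j hj => by rw [hlt j (Finset.mem_Iio.1 hj)]
    · exact Finset.sum_congr rfl fun j hj => by rw [hgt j (Finset.mem_Ioi.1 hj)]
  have hf : S.fsum w = S.f i (w i) + ∑ j ∈ Finset.Iio i, S.f j (x' j)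
      + ∑ j ∈ Finset.Ioi i, S.f j (x j) := by
    rw [SepProblem.fsum, sum_eq_add_sum_Iio_add_sum_Ioi _ i]
    congr 1
    · congr 1
      exact Finset.sum_congr rfl fun j hj => by rw [hlt j (Finset.mem_Iio.1 hj)]
    · exact Finset.sum_congr rfl fun j hj => by rw [hgt j (Finset.mem_Ioi.1 hj)]
  rw [SepProblem.xObjective, SepProblem.blockObjective, hA, hf]
  ring

/-- If no block update increases its block objective, a sweep does not increase the objective of
the `x`-subproblem. -/
lemma SepProblem.xObjective_le_of_blockObjective_le
    (h : ∀ i, S.blockObjective ρ x' x xbar z y i (x' i)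
      ≤ S.blockObjective ρ x' x xbar z y i (x i)) :
    S.xObjective ρ xbar z y x' ≤ S.xObjective ρ xbar z y x := by
  -- Hybrid points with the first `k` blocks updated; consecutive ones differ in a single block.
  let mix : ℕ → BlockVec n := fun k => WithLp.toLp 2 fun j => if j.val < k then x' j else x j
  have hmix : ∀ k j, mix k j = if j.val < k then x' j else x j := fun _ _ => rfl
  have hstep : ∀ k ≤ N, S.xObjective ρ xbar z y (mix k) ≤ S.xObjective ρ xbar z y x := by
    intro k
    induction k with
    | zero =>
      intro _
      have : mix 0 = x := by ext j : 1; simp [hmix]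
      rw [this]
    | succ k ih =>
      intro hk
      refine le_trans ?_ (ih (by omega))
      let i : Fin N := ⟨k, hk⟩
      have hi : i.val = k := rfl
      rw [SepProblem.xObjective_eq_blockObjective_add (x := x) (x' := x') (i := i) (w := mix (k + 1))
          (fun j hj => by rw [hmix, if_pos]; exact Nat.lt_succ_of_lt hj)
          (fun j hj => by rw [hmix, if_neg]; have : i.val < j.val := hj; omega),
        SepProblem.xObjective_eq_blockObjective_add (x := x) (x' := x') (i := i) (w := mix k)
          (fun j hj => by rw [hmix, if_pos]; exact hj)
          (fun j hj => by rw [hmix, if_neg]; have : i.val < j.val := hj; omega)]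
      rw [hmix, hmix, if_pos (by omega), if_neg (by omega)]
      exact add_le_add_left (h i) _
  have hN : mix N = x' := by ext j : 1; simp [hmix]
  exact hN ▸ hstep N le_rfl

lemma SepProblem.bddBelow_blockObjective (hρ : 0 ≤ ρ) {i : Fin N}
    (hf : BddBelow (range (S.f i))) :
    BddBelow (range (S.blockObjective ρ x' x xbar z y i)) := by
  obtain ⟨c, hc⟩ := hf
  refine ⟨c, ?_⟩
  rintro _ ⟨u, rfl⟩
  have h1 := hc (mem_range_self u)
  rw [SepProblem.blockObjective]
  refine h1.trans (le_add_of_nonneg_right (by positivity))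

lemma SepProblem.bddBelow_fsum (hf : ∀ i, BddBelow (range (S.f i))) :
    BddBelow (range S.fsum) := by
  choose c hc using hf
  refine ⟨∑ i, c i, ?_⟩
  rintro _ ⟨x, rfl⟩
  exact Finset.sum_le_sum fun i _ => hc i (mem_range_self _)

/-- Subtracting the gradient of the penalty term from a Clarke subgradient of the objective of the
`x`-subproblem gives a Clarke subgradient of `f`. -/
lemma SepProblem.sub_mulAT_mem_clarkeSubdiff {ξ : BlockVec n}
    (hξ : ξ ∈ clarkeSubdiff (S.xObjective ρ xbar z y) x) :
    ξ - ρ • S.mulAT (S.mulA x + (S.mulB xbar + z - S.b + ρ⁻¹ • y)) ∈ clarkeSubdiff S.fsum x := by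
  set c := S.mulB xbar + z - S.b + ρ⁻¹ • y with hc
  have hobj : S.xObjective ρ xbar z y
      = fun w => S.fsum w + ρ / 2 * ‖S.mulAL w + c‖ ^ 2 := by
    funext w
    rw [SepProblem.xObjective, SepProblem.mulAL_apply, hc]
    congr 4
    abel
  rw [hobj] at hξ
  refine sub_mem_clarkeSubdiff (fun d => ?_) hξ
  have := tendsto_diffQuot_sq_norm S.mulAL c ρ x d
  rwa [S.mulAL_apply x, S.mulAL_apply d, ← S.inner_mulAT, ← real_inner_smul_left] at this

/-- A Clarke subdifferential that is close to `0` has an element that is equally small. -/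
lemma exists_mem_clarkeSubdiff_norm_le {E : Type*} [NormedAddCommGroup E] [InnerProductSpace ℝ E]
    [ProperSpace E] {h : E → ℝ} {x : E} {c : ℝ} (hc : 0 ≤ c)
    (hle : Metric.infEDist 0 (clarkeSubdiff h x) ≤ ENNReal.ofReal c) :
    ∃ ξ ∈ clarkeSubdiff h x, ‖ξ‖ ≤ c := by
  -- The extended distance to the empty set is `⊤`, so a finite bound yields an element.
  have hne : (clarkeSubdiff h x).Nonempty := by
    rw [nonempty_iff_ne_empty]
    intro h0
    rw [h0, Metric.infEDist_empty] at hle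
    exact ENNReal.ofReal_ne_top (top_le_iff.1 hle)
  obtain ⟨ξ, hξ, heq⟩ := (isClosed_clarkeSubdiff h x).exists_infDist_eq_dist hne 0
  refine ⟨ξ, hξ, ?_⟩
  rw [← dist_zero_left, ← heq]
  exact ENNReal.toReal_le_of_le_ofReal hc hle

end Inner

/-! ### Lagrangian descent and finite termination of the inner loop -/

section Loop

variable {N p m : ℕ} {n : Fin N → ℕ} {S : SepProblem n p m} {P : TRParams} {lam : Vec m}
  {β ρ : ℝ} {G : Vec m → Vec p} {tol : Tolerances} {R : InnerRun n p m}

lemma InnerRun.Reaches.mono {r r' : ℕ} (h : R.Reaches S ρ tol r) (hr : r' ≤ r) :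
    R.Reaches S ρ tol r' := fun q hq => h q (hq.trans_le hr)

lemma IsInnerRun.terminates (hR : IsInnerRun S P G lam β ρ tol R) (hρ : 0 ≤ ρ)
    (hf : ∀ i, BddBelow (range (S.f i))) (htol : ∀ r, 0 < tol.radius r)
    (hH : ∀ r, R.Reaches S ρ tol r → ∀ i, HessianGrowth (tol.radius r) (R.tr r i))
    {r : ℕ} (hr : R.Reaches S ρ tol r) (i : Fin N) : (R.tr r i).Terminates (tol.radius r) :=
  (hR.solver r hr i).terminates (htol r) (SepProblem.bddBelow_blockObjective hρ (hf i)) (hH r hr i)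

lemma InnerRun.finalRadius_le
    {r : ℕ} (htol : 0 < tol.radius r) (hT : ∀ i, (R.tr r i).Terminates (tol.radius r)) :
    R.finalRadius tol r ≤ tol.radius r := by
  rw [InnerRun.finalRadius]
  -- Positivity of the tolerance covers `N = 0`, where the supremum is `0`.
  exact Real.iSup_le (fun i => (hT i).stopIndex_le) htol.le

lemma IsInnerRun.multiplier_eq (hR : IsInnerRun S P G lam β (2 * β) tol R) (hβ : 0 < β) :
    ∀ {r : ℕ}, R.Reaches S (2 * β) tol r → lam + β • R.z r + R.y r = 0 ∧
      lam + β • R.z (r + 1) + R.y (r + 1) = 0 := by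
  have hnext : ∀ {r : ℕ}, R.Reaches S (2 * β) tol r →
      lam + β • R.z (r + 1) + R.y (r + 1) = 0 := by
    intro r hr
    refine multiplier_update (c := S.mulA (R.x (r + 1)) + S.mulB (R.xbar (r + 1)) - S.b)
      (y := R.y r) hβ ?_ ?_
    · rw [hR.z_update r hr]; congr 3; abel
    · rw [hR.y_update r hr]; congr 2; abel
  intro r hr
  refine ⟨?_, hnext hr⟩
  cases r with
  | zero => exact hR.init
  | succ r => exact hnext (hr.mono r.le_succ)

/-- The augmented Lagrangian at the iterate of index `r`. -/
noncomputable def InnerRun.lagrangian (R : InnerRun n p m) (S : SepProblem n p m) (lam : Vec m)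
    (β : ℝ) (r : ℕ) : ℝ :=
  S.fsum (R.x r) + S.g (R.xbar r) + slackLagrangian lam β
    (S.mulA (R.x r) + S.mulB (R.xbar r) - S.b) (R.z r) (R.y r)

/-- The block sweep does not increase the Lagrangian, the `x̄`-step gains `ρ/2 = β` times the
squared change of `B x̄`, and the `z`- and `y`-steps together gain exactly `β‖Δz‖²`. -/
lemma IsInnerRun.lagrangian_descent (hR : IsInnerRun S P G lam β (2 * β) tol R) (hβ : 0 < β)
    (hg : ConvexOn ℝ univ S.g) (hG : ∀ v, IsMinOn (S.xbarObjective (2 * β) v) univ (G v))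
    {r : ℕ} (hr : R.Reaches S (2 * β) tol r) :
    R.lagrangian S lam β (r + 1) + β * ‖S.mulB (R.xbar (r + 1)) - S.mulB (R.xbar r)‖ ^ 2
      + β * ‖R.z (r + 1) - R.z r‖ ^ 2 ≤ R.lagrangian S lam β r := by
  obtain ⟨h0, h1⟩ := hR.multiplier_eq hβ hr
  have hx : S.xObjective (2 * β) (R.xbar r) (R.z r) (R.y r) (R.x (r + 1))
      ≤ S.xObjective (2 * β) (R.xbar r) (R.z r) (R.y r) (R.x r) :=
    SepProblem.xObjective_le_of_blockObjective_le fun i => by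
      have := (hR.solver r hr i).apply_stop_le
      rwa [← hR.x_update r hr i] at this
  have hb := add_sq_norm_add_le_of_isMinOn hg (Matrix.toEuclideanLin S.B)
    (hR.xbar_update r hr ▸ hG _) (R.xbar r)
  have hz := slackLagrangian_update (c := S.mulA (R.x (r + 1)) + S.mulB (R.xbar (r + 1)) - S.b)
    hβ h0 h1 (by rw [hR.y_update r hr]; congr 2; abel)
  change _ + _ * ‖S.mulB _ + _‖ ^ 2 + _ * ‖S.mulB _ - S.mulB _‖ ^ 2 ≤ _ + _ * ‖S.mulB _ + _‖ ^ 2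
    at hb
  rw [InnerRun.lagrangian, InnerRun.lagrangian]
  rw [slackLagrangian_eq lam hβ _ (R.z r)] at hz ⊢
  simp only [SepProblem.xObjective] at hx
  have e1 : ∀ (a c d : Vec m), a + c - S.b + R.z r + d = a + c + R.z r - S.b + d := by
    intros; abel
  have e2 : ∀ (a c d : Vec m), c + (a + R.z r - S.b + d) = a + c + R.z r - S.b + d := by
    intros; abel
  rw [e1] at hz ⊢
  rw [e2, e2] at hb
  nlinarith

lemma bddBelow_lagrangian (hβ : 0 < β) (hf : ∀ i, BddBelow (range (S.f i)))
    (hg : BddBelow (range S.g)) (h : ∀ r, lam + β • R.z r + R.y r = 0) :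
    BddBelow (range (R.lagrangian S lam β)) := by
  obtain ⟨cf, hcf⟩ := SepProblem.bddBelow_fsum hf
  obtain ⟨cg, hcg⟩ := hg
  refine ⟨cf + cg + -(1 / (2 * β) * ‖lam‖ ^ 2), ?_⟩
  rintro _ ⟨r, rfl⟩
  exact add_le_add (add_le_add (hcf (mem_range_self _)) (hcg (mem_range_self _)))
    (slackLagrangian_ge hβ (h r))

lemma tendsto_zero_of_mul_sq_norm_le {F : Type*} [NormedAddCommGroup F] {v : ℕ → F} {a : ℕ → ℝ}
    (hβ : 0 < β) (ha : Tendsto a atTop (𝓝 0)) (h : ∀ r, β * ‖v r‖ ^ 2 ≤ a r) :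
    Tendsto v atTop (𝓝 0) := by
  rw [tendsto_zero_iff_norm_tendsto_zero]
  have hsq : Tendsto (fun r => ‖v r‖ ^ 2) atTop (𝓝 0) := by
    refine squeeze_zero (fun r => by positivity) (fun r => ?_)
      (by simpa using ha.const_mul β⁻¹)
    rw [inv_mul_eq_div, le_div_iff₀' hβ]
    exact h r
  have := (Real.continuous_sqrt.tendsto 0).comp hsq
  rw [Real.sqrt_zero] at this
  exact this.congr fun r => Real.sqrt_sq (norm_nonneg _)

lemma IsInnerRun.exists_stop (hR : IsInnerRun S P G lam β (2 * β) tol R) (hβ : 0 < β)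
    (hf : ∀ i, BddBelow (range (S.f i))) (hg_bdd : BddBelow (range S.g))
    (hg : ConvexOn ℝ univ S.g) (hG : ∀ v, IsMinOn (S.xbarObjective (2 * β) v) univ (G v))
    (hε₁ : 0 < tol.ε₁) (hε₂ : 0 < tol.ε₂) (hε₃ : 0 < tol.ε₃)
    (hrad : ∃ᶠ r in atTop, tol.radius r ≤ tol.ε₄)
    (hfin : ∀ r, R.Reaches S (2 * β) tol r → R.finalRadius tol r ≤ tol.radius r) :
    ∃ r, R.Stop S (2 * β) tol r := by
  by_contra! hnot
  have hreach : ∀ r, R.Reaches S (2 * β) tol r := fun _ r' _ => hnot r'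
  have hdesc := fun r => hR.lagrangian_descent hβ hg hG (hreach r)
  have hmult := fun r => (hR.multiplier_eq hβ (hreach r)).1
  have hlim := tendsto_sub_succ_of_antitone (a := R.lagrangian S lam β)
    (antitone_nat_of_succ_le fun r => by
      have := hdesc r
      have : 0 ≤ β * ‖S.mulB (R.xbar (r + 1)) - S.mulB (R.xbar r)‖ ^ 2 := by positivity
      have : 0 ≤ β * ‖R.z (r + 1) - R.z r‖ ^ 2 := by positivity
      linarith)
    (bddBelow_lagrangian hβ hf hg_bdd hmult)
  have hB : Tendsto (fun r => S.mulB (R.xbar (r + 1)) - S.mulB (R.xbar r)) atTop (𝓝 0) :=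
    tendsto_zero_of_mul_sq_norm_le hβ hlim fun r => by
      have := hdesc r
      have : 0 ≤ β * ‖R.z (r + 1) - R.z r‖ ^ 2 := by positivity
      linarith
  have hz : Tendsto (fun r => R.z (r + 1) - R.z r) atTop (𝓝 0) :=
    tendsto_zero_of_mul_sq_norm_le hβ hlim fun r => by
      have := hdesc r
      have : 0 ≤ β * ‖S.mulB (R.xbar (r + 1)) - S.mulB (R.xbar r)‖ ^ 2 := by positivity
      linarith
  have hlt : ∀ {F : Type} [NormedAddCommGroup F] [NormedSpace ℝ F] (T : Vec m →ₗ[ℝ] F)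
      {v : ℕ → Vec m} {ε : ℝ}, 0 < ε → Tendsto v atTop (𝓝 0) → ∀ᶠ r in atTop, ‖T (v r)‖ ≤ ε := by
    intro F _ _ T v ε hε hv
    have hc : Tendsto (fun r => ‖T (v r)‖) atTop (𝓝 0) := by
      have := (T.toContinuousLinearMap.continuous.norm.tendsto 0).comp hv
      simpa [Function.comp_def] using this
    exact hc.eventually_le_const hε
  have h1 := hlt ((2 * β) • S.mulATL) hε₁ (by simpa using hB.add hz)
  have h2 := hlt ((2 * β) • S.mulBTL) hε₂ hz
  -- The residual is `-Δz/2`, as verified in the last bullet.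
  have h3 := hlt ((-(1 / 2 : ℝ)) • LinearMap.id) hε₃ hz
  -- The norm tests hold eventually, the radius test only infinitely often; together they meet.
  obtain ⟨r, hrle, hr1, hr2, hr3⟩ := (hrad.and_eventually (h1.and (h2.and h3))).exists
  refine hnot r ⟨?_, hr2, ?_, hfin r (hreach r), hrle⟩
  · refine (le_of_eq ?_).trans hr1
    have : S.mulB (R.xbar (r + 1)) + R.z (r + 1) - S.mulB (R.xbar r) - R.z r
        = S.mulB (R.xbar (r + 1)) - S.mulB (R.xbar r) + (R.z (r + 1) - R.z r) := by abel
    rw [this]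
    rfl
  · refine (le_of_eq ?_).trans hr3
    congr 1
    have hy := hR.y_update r (hreach r)
    rw [eq_neg_of_add_eq_zero_right (hmult r), eq_neg_of_add_eq_zero_right (hmult (r + 1))] at hy
    set w := S.mulA (R.x (r + 1)) + S.mulB (R.xbar (r + 1)) + R.z (r + 1) - S.b
    have hw : (2 * β) • w = -(β • (R.z (r + 1) - R.z r)) := by
      rw [eq_sub_of_add_eq' hy.symm, smul_sub]; abel
    have hw' : w = (2 * β)⁻¹ • -(β • (R.z (r + 1) - R.z r)) := by
      rw [← hw, smul_smul, inv_mul_cancel₀ (by positivity), one_smul]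
    rw [hw', ← neg_smul, smul_smul]
    show _ = (-(1 / 2 : ℝ)) • (R.z (r + 1) - R.z r)
    congr 1
    field_simp

end Loop

end TwoLevelADMM

/-! ### Approximate stationarity at the stopping index -/

theorem mainTheorem5 {N p m : ℕ} {n : Fin N → ℕ}
    (S : TwoLevelADMM.SepProblem n p m) (P : TwoLevelADMM.TRParams)
    (hf_lip : ∀ i, LocallyLipschitz (S.f i))
    (hf_bdd : ∀ i, BddBelow (Set.range (S.f i)))
    (hg_bdd : BddBelow (Set.range S.g))
    (hg_convex : ConvexOn ℝ Set.univ S.g)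
    (lam : EuclideanSpace ℝ (Fin m)) (β ρ : ℝ) (hβ : 0 < β) (hρ : ρ = 2 * β)
    (G : EuclideanSpace ℝ (Fin m) → EuclideanSpace ℝ (Fin p))
    (hG : ∀ v u, IsMinOn (S.xbarObjective ρ v) Set.univ u ↔ u = G v)
    (tol : TwoLevelADMM.Tolerances)
    (hε₁ : 0 < tol.ε₁) (hε₂ : 0 < tol.ε₂) (hε₃ : 0 < tol.ε₃) (hε₄ : 0 < tol.ε₄)
    (hradius_pos : ∀ r, 0 < tol.radius r)
    (hradius_le : ∃ᶠ r in Filter.atTop, tol.radius r ≤ tol.ε₄)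
    (R : TwoLevelADMM.InnerRun n p m)
    (hR : TwoLevelADMM.IsInnerRun S P G lam β ρ tol R)
    (hH : ∀ r, R.Reaches S ρ tol r → ∀ i,
      TwoLevelADMM.HessianGrowth (tol.radius r) (R.tr r i))
    (C₂ : ℝ) (hC₂ : 0 < C₂)
    (hClarke : ∀ r, R.Reaches S ρ tol r → (∀ i, (R.tr r i).Terminates (tol.radius r)) →
      Metric.infEDist 0 (TwoLevelADMM.clarkeSubdiff
        (S.xObjective ρ (R.xbar r) (R.z r) (R.y r)) (R.x (r + 1)))
          ≤ ENNReal.ofReal (C₂ * R.finalRadius tol r)) :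
    (∀ r, R.Reaches S ρ tol r → ∀ i, (R.tr r i).Terminates (tol.radius r)) ∧
    ∃ r, R.Reaches S ρ tol r ∧ R.Stop S ρ tol r ∧
      ∃ (d₁ d₄ : TwoLevelADMM.BlockVec n) (d₂ : EuclideanSpace ℝ (Fin p))
        (d₃ : EuclideanSpace ℝ (Fin m)),
        d₁ + d₄ ∈ (fun ξ => ξ + S.mulAT (R.y (r + 1))) ''
          TwoLevelADMM.clarkeSubdiff S.fsum (R.x (r + 1)) ∧
        d₂ ∈ (fun ξ => ξ + S.mulBT (R.y (r + 1))) ''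
          TwoLevelADMM.convexSubdiff S.g (R.xbar (r + 1)) ∧
        0 = lam + β • R.z (r + 1) + R.y (r + 1) ∧
        d₃ = S.mulA (R.x (r + 1)) + S.mulB (R.xbar (r + 1)) + R.z (r + 1) - S.b ∧
        ‖d₁‖ ≤ tol.ε₁ ∧ ‖d₂‖ ≤ tol.ε₂ ∧ ‖d₃‖ ≤ tol.ε₃ ∧ ‖d₄‖ ≤ C₂ * tol.ε₄ := by
  subst hρ
  have hρ : 0 < 2 * β := by positivity
  have hterm : ∀ r, R.Reaches S (2 * β) tol r → ∀ i, (R.tr r i).Terminates (tol.radius r) :=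
    fun r hr i => hR.terminates hρ.le hf_bdd hradius_pos hH hr i
  have hGmin : ∀ v, IsMinOn (S.xbarObjective (2 * β) v) Set.univ (G v) :=
    fun v => (hG v _).2 rfl
  refine ⟨hterm, ?_⟩
  have hex := hR.exists_stop hβ hf_bdd hg_bdd hg_convex hGmin hε₁ hε₂ hε₃ hradius_le
    fun r hr => TwoLevelADMM.InnerRun.finalRadius_le (hradius_pos r) (hterm r hr)
  classical
  -- The least stopping index is needed: the updates are only prescribed as long as the loop has not
  -- stopped before.
  have hr : R.Reaches S (2 * β) tol (Nat.find hex) := fun r' hr' => Nat.find_min hex hr'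
  have hfound := Nat.find_spec hex
  set r := Nat.find hex
  obtain ⟨hs1, hs2, hs3, hs4, hs5⟩ := hfound
  have hΔ : R.finalRadius tol r ≤ tol.ε₄ := hs4.trans hs5
  obtain ⟨ξ, hξ, hξn⟩ := TwoLevelADMM.exists_mem_clarkeSubdiff_norm_le
    (mul_nonneg hC₂.le hε₄.le) ((hClarke r hr (hterm r hr)).trans
      (ENNReal.ofReal_le_ofReal (mul_le_mul_of_nonneg_left hΔ hC₂.le)))
  have hy := hR.y_update r hr
  have hres : ∀ v : EuclideanSpace ℝ (Fin m), (2 * β) • ((2 * β)⁻¹ • v) = v := fun v => by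
    rw [smul_smul, mul_inv_cancel₀ hρ.ne', one_smul]
  -- `d₁`, `d₂`, `d₃` are the vectors in the stopping tests; `d₄` is the small Clarke subgradient
  -- `ξ` of the `x`-objective.
  refine ⟨r, hr, ⟨hs1, hs2, hs3, hs4, hs5⟩, _, ξ, _, _, ⟨_, S.sub_mulAT_mem_clarkeSubdiff hξ, ?_⟩,
    ⟨-S.mulBT (R.y (r + 1)) + (2 * β) • S.mulBT (R.z (r + 1) - R.z r), fun u => ?_, ?_⟩,
    (hR.multiplier_eq hβ hr).2.symm, rfl, hs1, hs2, hs3, hξn⟩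
  · change ξ - (2 * β) • S.mulATL _ + S.mulATL _ = (2 * β) • S.mulATL _ + ξ
    rw [sub_add_eq_add_sub, sub_eq_iff_eq_add, hy]
    rw [← map_smul S.mulATL, ← map_smul S.mulATL, add_right_comm (S.mulATL _), ← map_add, add_comm ξ]
    congr 1
    congr 1
    -- The multiplier update uses the new `x̄` and `z`, the penalty gradient the old ones; their
    -- difference is `d₁`.
    simp only [smul_add, smul_sub, hres]
    abel
  · have h := TwoLevelADMM.le_of_isMinOn_add_sq_norm hg_convex (Matrix.toEuclideanLin S.B)
      (hR.xbar_update r hr ▸ hGmin _) u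
    refine le_trans (le_of_eq ?_) h
    rw [sub_eq_add_neg (S.g _), ← real_inner_smul_left, ← inner_neg_left]
    congr 1
    change inner ℝ (-S.mulBTL _ + (2 * β) • S.mulBTL _) _ = _
    rw [← map_neg, ← map_smul, ← map_add]
    change inner ℝ (S.mulBT _) _ = _
    rw [S.inner_mulBT]
    change inner ℝ _ (S.mulB _) = inner ℝ (-((2 * β) • (S.mulB _ + _))) (S.mulB _)
    congr 1
    -- The penalty gradient still contains the old `z`; replacing it by the new one leaves `ρ Bᵀ
    -- Δz`, which is `d₂`.
    rw [hy]
    simp only [smul_add, smul_sub, hres]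
    abel
  · change -S.mulBT _ + _ + S.mulBT _ = _
    abel
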